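/- Let $\mathcal C$ be an elementary topos (finite limits, cartesian closed, with a subobject classifier $\Omega$), let $X$ be an object, and write $PX=\Omega^X$. All formulas below are formulas of the internal language of $\mathcal C$, and to assert one means that it is valid. In $PX$, $A\wedge B$, $A\vee B$, $A\Rightarrow B$, $\neg A$, $\emptyset$, $X$ are the operations on parts of $X$ given by comprehension, and $A\preceq_X B$ means $A\wedge B=A$. For a variable $F:PPX$, let $\mathcal F(F)$ say that $F$ is a filter in $X$: $\forall A,B.\ A\in F\wedge B\in F\Rightarrow A\wedge B\in F$; $\forall A,B.\ A\in F\wedge A\preceq_X B\Rightarrow B\in F$; $X\in F$; and $\forall A.\ A\in F\Rightarrow\exists x.\ x\in A$. Let $N:X\to PPX$ be a topological neighborhood, i.e. a morphism such that $$\forall x.\ \mathcal F(N(x)),\qquad \forall x.\forall A.\ A\in N(x)\Rightarrow x\in A,$$ $$\forall x.\forall A.\ A\in N(x)\Rightarrow\exists B.\ \bigl(B\in N(x)\wedge\forall y.\ (y\in B\Rightarrow A\in N(y))\bigr).$$ Define $\varepsilon[N],\delta[N]:PX\to PX$ by $$\varepsilon[N](Y)=\{x\mid Y\in N(x)\},\qquad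 \delta[N](Y)=\{x\mid\exists F.\ \mathcal F(F)\wedge Y\in F\wedge N(x)\preceq_{PX}F\}.$$ Then also $\delta[N](Y)=\{x\mid\forall A.\ A\in N(x)\Rightarrow\exists y.\ y\in A\wedge Y\}$, and 1. $\forall Y.\ Y\preceq_X\delta[N](Y)$; 2. $\delta[N](\emptyset)=\emptyset$; 3. $\forall Y.\ \delta[N](\delta[N](Y))=\delta[N](Y)$. Moreover $(PX,\preceq_X,\wedge,\vee,\Rightarrow,\neg,\emptyset,X,\varepsilon[N],\delta[N])$ is an internal CS4-modal algebra: it is an internal Heyting algebra, and with $\Box=\varepsilon[N]$ and $\Diamond=\delta[N]$ the following hold for all $a,b$: $\Box a\preceq a$, $\Box X=X$, $\Box(a\wedge b)=\Box a\wedge\Box b$, $\Box\Box a=\Box a$; $\Diamond$ is monotone, $a\preceq\Diamond a$, $\Diamond\Diamond a=\Diamond a$; $\Box(a\Rightarrow b)\preceq(\Diamond a\Rightarrow\Diamond b)$ and $\Box a\wedge\Diamond b\preceq\Diamond(\Box a\wedge b)$. -/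

import Mathlib

open CategoryTheory Limits MonoidalCategory CartesianMonoidalCategory

universe v u

set_option linter.unusedSectionVars false

namespace ToposLogic

noncomputable section

/-! An elementary topos is a category `C` with finite limits (the finite products being given by
the cartesian monoidal structure), exponentials and a subobject classifier.  The internal language
is interpreted as usual: a term of type `X` in the context `Γ` is a morphism `Γ ⟶ X`, and a formula
in the context `Γ` is a subobject of `Γ`. -/

section Logic

variable {C : Type u} [Category.{v} C] [CartesianMonoidalCategory C] [HasFiniteLimits C]
  [HasSubobjectClassifier C]

/-- The object of truth values. -/
abbrev Om (C : Type u) [Category.{v} C] [HasSubobjectClassifier C] : C :=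
  HasSubobjectClassifier.Ω C

/-- The characteristic morphism of a subobject. -/
def chr {Γ : C} (φ : Subobject Γ) : Γ ⟶ Om C := HasSubobjectClassifier.χ φ.arrow

/-- A term of type `Ω`, regarded as a formula: the subobject that it classifies. -/
def holds {Γ : C} (t : Γ ⟶ Om C) : Subobject Γ :=
  (Subobject.pullback t).obj (Subobject.mk (HasSubobjectClassifier.truth C))

@[simp]
theorem holds_chr {Γ : C} (φ : Subobject Γ) : holds (chr φ) = φ := by
  have h := Subobject.Classifier.pullback_χ_obj_mk_truth
    (HasSubobjectClassifier.exists_classifier (C := C)).some φ.arrow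
  rw [Subobject.mk_arrow] at h
  exact h

@[simp]
theorem chr_holds {Γ : C} (t : Γ ⟶ Om C) : chr (holds t) = t :=
  Subobject.Classifier.χ_pullback_obj_mk_truth_arrow
    (HasSubobjectClassifier.exists_classifier (C := C)).some t

theorem holds_comp {Δ Γ : C} (g : Δ ⟶ Γ) (t : Γ ⟶ Om C) :
    holds (g ≫ t) = (Subobject.pullback g).obj (holds t) := by
  simp only [holds, Subobject.pullback_comp]

theorem comp_chr {Δ Γ : C} (g : Δ ⟶ Γ) (φ : Subobject Γ) :
    g ≫ chr φ = chr ((Subobject.pullback g).obj φ) := by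
  rw [← chr_holds (g ≫ chr φ), holds_comp, holds_chr]

theorem chr_inj {Γ : C} {φ ψ : Subobject Γ} : chr φ = chr ψ ↔ φ = ψ :=
  ⟨fun h => by rw [← holds_chr φ, h, holds_chr], fun h => by rw [h]⟩

theorem sub_le_iff {Γ : C} {φ ψ : Subobject Γ} :
    φ ≤ ψ ↔ ∀ {Δ : C} (g : Δ ⟶ Γ), φ.Factors g → ψ.Factors g :=
  ⟨fun h _ g => Subobject.factors_of_le g h,
    fun h => Subobject.le_of_factors (h _ (Subobject.factors_self φ))⟩

theorem sub_ext_iff {Γ : C} {φ ψ : Subobject Γ} :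
    φ = ψ ↔ ∀ {Δ : C} (g : Δ ⟶ Γ), φ.Factors g ↔ ψ.Factors g :=
  ⟨fun h _ _ => by rw [h], fun h =>
    le_antisymm (sub_le_iff.2 fun g => (h g).1) (sub_le_iff.2 fun g => (h g).2)⟩

theorem factors_comp {Δ' Δ Γ : C} {φ : Subobject Γ} (h : Δ' ⟶ Δ) {g : Δ ⟶ Γ}
    (hg : φ.Factors g) : φ.Factors (h ≫ g) :=
  Subobject.factors_of_factors_right h hg

/-! ### Propositional connectives

Truth and conjunction are `⊤` and `⊓` of the lattice of subobjects. -/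

/-- The equality formula `σ = τ`. -/
def eqF {Γ X : C} (σ τ : Γ ⟶ X) : Subobject Γ := equalizerSubobject σ τ

/-- Implication in the Heyting algebra of subobjects. -/
def impF {Γ : C} (φ ψ : Subobject Γ) : Subobject Γ :=
  equalizerSubobject (chr (φ ⊓ ψ)) (chr φ)

theorem impF_factors {Δ Γ : C} (φ ψ : Subobject Γ) (g : Δ ⟶ Γ) :
    (impF φ ψ).Factors g ↔
      ∀ {Δ' : C} (h : Δ' ⟶ Δ), φ.Factors (h ≫ g) → ψ.Factors (h ≫ g) := by
  rw [impF, equalizerSubobject_factors_iff, comp_chr, comp_chr, chr_inj, sub_ext_iff]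
  simp only [pullback_factors_iff, Subobject.inf_factors]
  exact ⟨fun H Δ' h hφ => ((H h).2 hφ).2, fun H Δ' h => ⟨fun q => q.1, fun q => ⟨q, H h q⟩⟩⟩

theorem le_impF_iff {Γ : C} (θ φ ψ : Subobject Γ) : θ ≤ impF φ ψ ↔ θ ⊓ φ ≤ ψ := by
  constructor
  · intro H
    refine sub_le_iff.2 fun g hg => ?_
    rw [Subobject.inf_factors] at hg
    have := (impF_factors φ ψ g).1 (Subobject.factors_of_le g H hg.1) (𝟙 _)
    rw [Category.id_comp] at this
    exact this hg.2
  · intro H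
    refine sub_le_iff.2 fun g hg => (impF_factors φ ψ g).2 fun h hφ => ?_
    exact Subobject.factors_of_le _ H ((Subobject.inf_factors _).2 ⟨factors_comp h hg, hφ⟩)

/-- The biconditional. -/
def iffF {Γ : C} (φ ψ : Subobject Γ) : Subobject Γ := impF φ ψ ⊓ impF ψ φ

variable [MonoidalClosed C]

/-! ### The quantifiers

The new variable is the first factor of the enlarged context `X ⊗ Γ`. -/

/-- Universal quantification along the projection `X ⊗ Γ ⟶ Γ`. -/
def forallSub (X : C) {Γ : C} (φ : Subobject (X ⊗ Γ)) : Subobject Γ :=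
  equalizerSubobject (MonoidalClosed.curry (chr φ))
    (MonoidalClosed.curry (chr (⊤ : Subobject (X ⊗ Γ))))

theorem forallSub_factors {X Δ Γ : C} (φ : Subobject (X ⊗ Γ)) (g : Δ ⟶ Γ) :
    (forallSub X φ).Factors g ↔
      ∀ {Δ' : C} (h : Δ' ⟶ Δ) (x : Δ' ⟶ X), φ.Factors (lift x (h ≫ g)) := by
  rw [forallSub, equalizerSubobject_factors_iff, ← MonoidalClosed.curry_natural_left,
    ← MonoidalClosed.curry_natural_left, MonoidalClosed.curry_injective.eq_iff, comp_chr,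
    comp_chr, chr_inj, Subobject.pullback_top, sub_ext_iff]
  simp only [pullback_factors_iff, Subobject.top_factors, iff_true]
  constructor
  · intro H Δ' h x
    have := H (lift x h)
    rwa [lift_whiskerLeft] at this
  · intro H Δ' k
    have := H (k ≫ snd _ _) (k ≫ fst _ _)
    have e : k ≫ X ◁ g = lift (k ≫ fst _ _) ((k ≫ snd _ _) ≫ g) := by
      ext <;> simp
    rwa [e]

/-- Universal quantification is right adjoint to pulling back along the projection. -/
theorem le_forallSub_iff {X Γ : C} (θ : Subobject Γ) (φ : Subobject (X ⊗ Γ)) :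
    θ ≤ forallSub X φ ↔ (Subobject.pullback (snd X Γ)).obj θ ≤ φ := by
  constructor
  · intro H
    refine sub_le_iff.2 fun k hk => ?_
    rw [pullback_factors_iff] at hk
    have := (forallSub_factors φ _).1 (Subobject.factors_of_le _ H hk) (𝟙 _) (k ≫ fst _ _)
    have e : lift (k ≫ fst X Γ) (𝟙 _ ≫ k ≫ snd _ _) = k := by ext <;> simp
    rwa [e] at this
  · intro H
    refine sub_le_iff.2 fun g hg => (forallSub_factors φ g).2 fun h x => ?_
    refine Subobject.factors_of_le _ H ((pullback_factors_iff _ _ _).2 ?_)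
    rw [lift_snd]
    exact factors_comp h hg

/-- `∀ x : X, φ`.  The body receives the weakening map, with which terms of the old context are
composed, and the new variable. -/
def allF (X : C) {Γ : C} (φ : (X ⊗ Γ ⟶ Γ) → (X ⊗ Γ ⟶ X) → Subobject (X ⊗ Γ)) : Subobject Γ :=
  forallSub X (φ (snd X Γ) (fst X Γ))

/-- Falsity, `∀ ω : Ω, ω`. -/
def botF (Γ : C) : Subobject Γ := allF (Om C) fun _ ω => holds ω

/-- Disjunction, `∀ ω : Ω, (φ ⇒ ω) ⇒ (ψ ⇒ ω) ⇒ ω`. -/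
def orF {Γ : C} (φ ψ : Subobject Γ) : Subobject Γ :=
  allF (Om C) fun w ω => impF (impF ((Subobject.pullback w).obj φ) (holds ω))
    (impF (impF ((Subobject.pullback w).obj ψ) (holds ω)) (holds ω))

/-- Negation, the pseudo-complement. -/
def negF {Γ : C} (φ : Subobject Γ) : Subobject Γ := impF φ (botF Γ)

theorem holds_factors_lift {Δ Γ : C} (ψ : Subobject Γ) (k : Δ ⟶ Γ) {Γ' : C} (r : Δ ⟶ Γ') :
    (holds (fst (Om C) Γ')).Factors (lift (k ≫ chr ψ) r) ↔ ψ.Factors k := by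
  rw [holds, pullback_factors_iff, lift_fst, ← pullback_factors_iff, ← holds, holds_chr]

/-- `botF` is the least subobject. -/
theorem botF_le {Γ : C} (ψ : Subobject Γ) : botF Γ ≤ ψ := by
  refine sub_le_iff.2 fun g hg => ?_
  have := (forallSub_factors _ g).1 hg (𝟙 _) (g ≫ chr ψ)
  exact (holds_factors_lift ψ g _).1 this

/-- `orF φ ψ` is the join of `φ` and `ψ`. -/
theorem isLUB_orF {Γ : C} (φ ψ : Subobject Γ) : IsLUB {φ, ψ} (orF φ ψ) := by
  constructor
  · intro θ hθ
    refine sub_le_iff.2 fun g hg => (forallSub_factors _ g).2 fun h x => ?_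
    refine (impF_factors _ _ _).2 fun k hk => (impF_factors _ _ _).2 fun l hl => ?_
    rcases hθ with rfl | rfl
    · have := (impF_factors _ _ _).1 hk l
        ((pullback_factors_iff _ _ _).2 (by
          simpa using factors_comp (l ≫ k ≫ h) hg))
      exact this
    · have := (impF_factors _ _ _).1 hl (𝟙 _)
        ((pullback_factors_iff _ _ _).2 (by
          simpa using factors_comp (l ≫ k ≫ h) hg))
      simpa using this
  · intro θ hθ
    have h1 : φ ≤ θ := hθ (by simp)
    have h2 : ψ ≤ θ := hθ (by simp)
    refine sub_le_iff.2 fun g hg => ?_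
    have h0 := (forallSub_factors _ g).1 hg (𝟙 _) (g ≫ chr θ)
    have aux : ∀ χ : Subobject Γ, χ ≤ θ →
        (impF ((Subobject.pullback (snd (Om C) Γ)).obj χ) (holds (fst (Om C) Γ))).Factors
          (lift (g ≫ chr θ) (𝟙 _ ≫ g)) := by
      intro χ hχ
      refine (impF_factors _ _ _).2 fun k hk => ?_
      rw [pullback_factors_iff, Category.assoc, lift_snd, Category.id_comp] at hk
      rw [comp_lift, ← Category.assoc]
      exact (holds_factors_lift θ _ _).2 (Subobject.factors_of_le _ hχ hk)
    have h3 := (impF_factors _ _ _).1 h0 (𝟙 _) (by simpa using aux φ h1)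
    have h4 := (impF_factors _ _ _).1 h3 (𝟙 _) (by simpa using aux ψ h2)
    rw [Category.id_comp, Category.id_comp] at h4
    exact (holds_factors_lift θ _ _).1 h4

/-- The image of a morphism `f` as the subobject
`{b | ∀ ω : Ω, (∀ a, f a = b ⇒ ω) ⇒ ω}` of its codomain. -/
def imageSub {A B : C} (f : A ⟶ B) : Subobject B :=
  allF (Om C) fun w ω =>
    impF (allF A fun w' a => impF (eqF (a ≫ f) (w' ≫ w)) (holds (w' ≫ ω))) (holds ω)

/-- `imageSub f` is the least subobject through which `f` factors. -/
theorem isLeast_imageSub {A B : C} (f : A ⟶ B) :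
    IsLeast {S : Subobject B | S.Factors f} (imageSub f) := by
  constructor
  · refine (forallSub_factors _ f).2 fun h ω => (impF_factors _ _ _).2 fun k hk => ?_
    have h1 := (forallSub_factors _ _).1 hk (𝟙 _) (k ≫ h)
    have h2 := (impF_factors _ _ _).1 h1 (𝟙 _)
      ((equalizerSubobject_factors_iff _ _ _).2 (by simp))
    rw [holds_comp, pullback_factors_iff] at h2
    simpa using h2
  · intro S hS
    refine sub_le_iff.2 fun g hg => ?_
    have h0 := (forallSub_factors _ g).1 hg (𝟙 _) (g ≫ chr S)
    have h1 := (impF_factors _ _ _).1 h0 (𝟙 _)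
      ((forallSub_factors _ _).2 fun h a => (impF_factors _ _ _).2 fun k hk => by
        have e := (equalizerSubobject_factors_iff _ _ _).1 hk
        have e' : k ≫ a ≫ f = k ≫ h ≫ g := by simpa using e
        rw [holds_comp, pullback_factors_iff]
        have : (k ≫ lift a (h ≫ 𝟙 _ ≫ lift (g ≫ chr S) (𝟙 _ ≫ g))) ≫ snd A (Om C ⊗ B) =
            lift ((k ≫ h ≫ g) ≫ chr S) (k ≫ h ≫ g) := by ext <;> simp
        rw [this, holds_factors_lift, ← e', ← Category.assoc]
        exact factors_comp _ hS)
    rw [Category.id_comp] at h1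
    exact (holds_factors_lift S _ _).1 h1

/-- A topos has images. -/
instance hasImages : HasImages C where
  has_image f := HasImage.mk
    { F :=
        { I := ((imageSub f : Subobject _) : C)
          m := (imageSub f).arrow
          e := (imageSub f).factorThru f (isLeast_imageSub f).1 }
      isImage :=
        { lift := fun F' => Subobject.ofLEMk (imageSub f) F'.m
            ((isLeast_imageSub f).2 ((Subobject.mk_factors_iff _ _).2 ⟨F'.e, F'.fac⟩))
          lift_fac := fun F' => Subobject.ofLEMk_comp _ } }

/-- Existential quantification: the image of `φ` under the projection `X ⊗ Γ ⟶ Γ`. -/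
def existsSub (X : C) {Γ : C} (φ : Subobject (X ⊗ Γ)) : Subobject Γ :=
  imageSubobject (φ.arrow ≫ snd X Γ)

/-- `∃ x : X, φ`, with the same conventions as for `allF`. -/
def exF (X : C) {Γ : C} (φ : (X ⊗ Γ ⟶ Γ) → (X ⊗ Γ ⟶ X) → Subobject (X ⊗ Γ)) : Subobject Γ :=
  existsSub X (φ (snd X Γ) (fst X Γ))

/-- Validity of a closed formula: it is the top element of the subobjects of the terminal
object. -/
def Valid (φ : Subobject (𝟙_ C)) : Prop := φ = ⊤

/-! ### Power objects -/

/-- The power object `P X`, the exponential `Ω ^ X`. -/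
abbrev P (X : C) : C := (ihom X).obj (Om C)

/-- The membership relation, a subobject of `X ⊗ P X` whose characteristic morphism is the
transpose of the identity of `P X`. -/
def elemSub (X : C) : Subobject (X ⊗ P X) := holds (MonoidalClosed.uncurry (𝟙 (P X)))

/-- The formula `σ ∈ τ`. -/
def memF {Γ X : C} (σ : Γ ⟶ X) (τ : Γ ⟶ P X) : Subobject Γ :=
  (Subobject.pullback (lift σ τ)).obj (elemSub X)

/-- The transpose of the characteristic morphism of a subobject of `X ⊗ Γ`. -/
def transpose {X Γ : C} (φ : Subobject (X ⊗ Γ)) : Γ ⟶ P X := MonoidalClosed.curry (chr φ)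

/-- The comprehension term `{x : X | φ}`, with the same conventions as for `allF`. -/
def setOfF (X : C) {Γ : C} (φ : (X ⊗ Γ ⟶ Γ) → (X ⊗ Γ ⟶ X) → Subobject (X ⊗ Γ)) : Γ ⟶ P X :=
  transpose (φ (snd X Γ) (fst X Γ))

/-- The defining property of comprehension, `t ∈ {x | φ}` if and only if `φ(t)`. -/
theorem memF_transpose {X Γ Δ : C} (φ : Subobject (X ⊗ Γ)) (t : Δ ⟶ X) (g : Δ ⟶ Γ) :
    memF t (g ≫ transpose φ) = (Subobject.pullback (lift t g)).obj φ := by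
  have e : lift t (g ≫ transpose φ) ≫ MonoidalClosed.uncurry (𝟙 (P X)) = lift t g ≫ chr φ := by
    rw [← lift_whiskerLeft, Category.assoc, ← MonoidalClosed.uncurry_natural_left,
      Category.comp_id, transpose, MonoidalClosed.uncurry_curry]
  rw [memF, elemSub, ← holds_comp, e, holds_comp, holds_chr]

/-- The whole of `X`, as a term of type `P X`. -/
def univT (Γ X : C) : Γ ⟶ P X := setOfF X fun _ _ => ⊤

/-- The empty part of `X`, as a term of type `P X`. -/
def emptyT (Γ X : C) : Γ ⟶ P X := setOfF X fun _ _ => botF _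

/-- Intersection `A ∧ B`. -/
def interT {Γ X : C} (A B : Γ ⟶ P X) : Γ ⟶ P X :=
  setOfF X fun w x => memF x (w ≫ A) ⊓ memF x (w ≫ B)

/-- Union `A ∨ B`. -/
def unionT {Γ X : C} (A B : Γ ⟶ P X) : Γ ⟶ P X :=
  setOfF X fun w x => orF (memF x (w ≫ A)) (memF x (w ≫ B))

/-- Implication `A ⇒ B` of parts of `X`. -/
def impT {Γ X : C} (A B : Γ ⟶ P X) : Γ ⟶ P X :=
  setOfF X fun w x => impF (memF x (w ≫ A)) (memF x (w ≫ B))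

/-- Pseudo-complement `¬ A`. -/
def complT {Γ X : C} (A : Γ ⟶ P X) : Γ ⟶ P X :=
  setOfF X fun w x => negF (memF x (w ≫ A))

/-- The order `≼` of `P X`, the subobject of `P X ⊗ P X` of the pairs with `A ∧ B = A`. -/
def leSub (X : C) : Subobject (P X ⊗ P X) :=
  eqF (interT (fst (P X) (P X)) (snd (P X) (P X))) (fst (P X) (P X))

/-- The formula `A ≼ B`. -/
def leF {Γ X : C} (A B : Γ ⟶ P X) : Subobject Γ :=
  (Subobject.pullback (lift A B)).obj (leSub X)

/-! ### Filters and neighborhoods -/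

/-- The subobject of `P (P X)` of (proper) filters. -/
def filterSub (X : C) : Subobject (P (P X)) :=
  let F : P (P X) ⟶ P (P X) := 𝟙 _
  (allF (P X) fun w A => allF (P X) fun w' B =>
      impF (memF (w' ≫ A) (w' ≫ w ≫ F) ⊓ memF B (w' ≫ w ≫ F))
        (memF (interT (w' ≫ A) B) (w' ≫ w ≫ F))) ⊓
  (allF (P X) fun w A => allF (P X) fun w' B =>
      impF (memF (w' ≫ A) (w' ≫ w ≫ F) ⊓ leF (w' ≫ A) B) (memF B (w' ≫ w ≫ F))) ⊓
  memF (univT _ X) F ⊓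
  (allF (P X) fun w A => impF (memF A (w ≫ F)) (exF X fun w' x => memF x (w' ≫ A)))

/-- The predicate `𝓕 : P (P X) ⟶ Ω` of being a filter. -/
def filterPred (X : C) : P (P X) ⟶ Om C := chr (filterSub X)

/-- A structuring neighborhood: every `N(x)` is a filter all of whose members contain `x`. -/
structure IsStructuringNbhd {X : C} (N : X ⟶ P (P X)) : Prop where
  filter : Valid (allF X fun _ x => holds ((x ≫ N) ≫ filterPred X))
  mem : Valid (allF X fun _ x => allF (P X) fun w A =>
    impF (memF A (w ≫ x ≫ N)) (memF (w ≫ x) A))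

/-- A topological neighborhood: moreover, every `A ∈ N(x)` admits `B ∈ N(x)` such that `A ∈ N(y)`
for all `y ∈ B`. -/
structure IsTopologicalNbhd {X : C} (N : X ⟶ P (P X)) : Prop extends IsStructuringNbhd N where
  topological : Valid (allF X fun _ x => allF (P X) fun w A =>
    impF (memF A (w ≫ x ≫ N))
      (exF (P X) fun w' B => memF B (w' ≫ w ≫ x ≫ N) ⊓
        allF X fun w'' y => impF (memF y (w'' ≫ B)) (memF (w'' ≫ w' ≫ A) (y ≫ N))))

/-- The erosion `ε[N](Y) = {x | Y ∈ N(x)}`. -/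
def erosion {X : C} (N : X ⟶ P (P X)) : P X ⟶ P X :=
  setOfF X fun w x => memF w (x ≫ N)

/-- The dilation `δ[N](Y) = {x | ∃ F, 𝓕(F) ∧ Y ∈ F ∧ N(x) ≼ F}`. -/
def dilation {X : C} (N : X ⟶ P (P X)) : P X ⟶ P X :=
  setOfF X fun w x => exF (P (P X)) fun w' F =>
    holds (F ≫ filterPred X) ⊓ memF (w' ≫ w) F ⊓ leF (w' ≫ x ≫ N) F

/-- The second description of the dilation,
`{x | ∀ A, A ∈ N(x) ⇒ ∃ y, y ∈ A ∧ Y}`. -/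
def dilationMeet {X : C} (N : X ⟶ P (P X)) : P X ⟶ P X :=
  setOfF X fun w x => allF (P X) fun w' A =>
    impF (memF A (w' ≫ x ≫ N))
      (exF X fun w'' y => memF y (interT (w'' ≫ A) (w'' ≫ w' ≫ w)))

/-! ### Internal CS4-modal algebras -/

/-- The operations of an internal Heyting algebra on `H` with two unary operators `box` and
`dia`. -/
structure ModalSignature (H : C) where
  /-- the order relation -/
  le : Subobject (H ⊗ H)
  /-- binary meet -/
  meet : H ⊗ H ⟶ H
  /-- binary join -/
  join : H ⊗ H ⟶ H
  /-- implication -/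
  imp : H ⊗ H ⟶ H
  /-- pseudo-complement -/
  neg : H ⟶ H
  /-- the greatest element -/
  top : 𝟙_ C ⟶ H
  /-- the least element -/
  bot : 𝟙_ C ⟶ H
  /-- the necessity operator -/
  box : H ⟶ H
  /-- the possibility operator -/
  dia : H ⟶ H

namespace ModalSignature

variable {H : C} (S : ModalSignature H) {Γ : C}

/-- The formula `a ≤ b`. -/
def leq (a b : Γ ⟶ H) : Subobject Γ := (Subobject.pullback (lift a b)).obj S.le

/-- The term `a ∧ b`. -/
def inf (a b : Γ ⟶ H) : Γ ⟶ H := lift a b ≫ S.meet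

/-- The term `a ∨ b`. -/
def sup (a b : Γ ⟶ H) : Γ ⟶ H := lift a b ≫ S.join

/-- The term `a ⇒ b`. -/
def himp (a b : Γ ⟶ H) : Γ ⟶ H := lift a b ≫ S.imp

/-- The constant `⊤` in the context `Γ`. -/
def one (Γ : C) : Γ ⟶ H := toUnit Γ ≫ S.top

/-- The constant `⊥` in the context `Γ`. -/
def zero (Γ : C) : Γ ⟶ H := toUnit Γ ≫ S.bot

/-- The laws of an internal Heyting algebra, as valid formulas of the internal language. -/
structure IsHeyting : Prop where
  refl : Valid (allF H fun _ a => S.leq a a)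
  trans : Valid (allF H fun _ a => allF H fun w b => allF H fun w' c =>
    impF (S.leq (w' ≫ w ≫ a) (w' ≫ b) ⊓ S.leq (w' ≫ b) c) (S.leq (w' ≫ w ≫ a) c))
  antisymm : Valid (allF H fun _ a => allF H fun w b =>
    impF (S.leq (w ≫ a) b ⊓ S.leq b (w ≫ a)) (eqF (w ≫ a) b))
  le_top : Valid (allF H fun _ a => S.leq a (S.one _))
  bot_le : Valid (allF H fun _ a => S.leq (S.zero _) a)
  le_inf : Valid (allF H fun _ a => allF H fun w b => allF H fun w' c =>
    iffF (S.leq c (S.inf (w' ≫ w ≫ a) (w' ≫ b)))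
      (S.leq c (w' ≫ w ≫ a) ⊓ S.leq c (w' ≫ b)))
  sup_le : Valid (allF H fun _ a => allF H fun w b => allF H fun w' c =>
    iffF (S.leq (S.sup (w' ≫ w ≫ a) (w' ≫ b)) c)
      (S.leq (w' ≫ w ≫ a) c ⊓ S.leq (w' ≫ b) c))
  le_himp : Valid (allF H fun _ a => allF H fun w b => allF H fun w' c =>
    iffF (S.leq c (S.himp (w' ≫ w ≫ a) (w' ≫ b)))
      (S.leq (S.inf c (w' ≫ w ≫ a)) (w' ≫ b)))
  neg_eq : Valid (allF H fun _ a => eqF (a ≫ S.neg) (S.himp a (S.zero _)))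

/-- An internal CS4-modal algebra: an internal Heyting algebra with an interior operator `box` and
a monotone, extensive and idempotent operator `dia`, not required to preserve joins, that are
linked by the laws of constructive S4. -/
structure IsCS4Algebra : Prop extends S.IsHeyting where
  box_le : Valid (allF H fun _ a => S.leq (a ≫ S.box) a)
  box_top : Valid (eqF (S.one _ ≫ S.box) (S.one _))
  box_inf : Valid (allF H fun _ a => allF H fun w b =>
    eqF (S.inf (w ≫ a) b ≫ S.box) (S.inf ((w ≫ a) ≫ S.box) (b ≫ S.box)))
  box_box : Valid (allF H fun _ a => eqF ((a ≫ S.box) ≫ S.box) (a ≫ S.box))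
  dia_mono : Valid (allF H fun _ a => allF H fun w b =>
    impF (S.leq (w ≫ a) b) (S.leq ((w ≫ a) ≫ S.dia) (b ≫ S.dia)))
  le_dia : Valid (allF H fun _ a => S.leq a (a ≫ S.dia))
  dia_dia : Valid (allF H fun _ a => eqF ((a ≫ S.dia) ≫ S.dia) (a ≫ S.dia))
  box_himp_le : Valid (allF H fun _ a => allF H fun w b =>
    S.leq (S.himp (w ≫ a) b ≫ S.box) (S.himp ((w ≫ a) ≫ S.dia) (b ≫ S.dia)))
  box_inf_dia_le : Valid (allF H fun _ a => allF H fun w b =>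
    S.leq (S.inf ((w ≫ a) ≫ S.box) (b ≫ S.dia)) (S.inf ((w ≫ a) ≫ S.box) b ≫ S.dia))

end ModalSignature

/-- The power object `P X` with its Heyting operations and the operators `ε[N]` and `δ[N]`. -/
def powerSignature {X : C} (N : X ⟶ P (P X)) : ModalSignature (P X) where
  le := leSub X
  meet := interT (fst _ _) (snd _ _)
  join := unionT (fst _ _) (snd _ _)
  imp := impT (fst _ _) (snd _ _)
  neg := complT (𝟙 _)
  top := univT _ X
  bot := emptyT _ X
  box := erosion N
  dia := dilation N

end Logic

end

end ToposLogic

namespace ToposLogic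

section

variable {C : Type u} [Category.{v} C] [CartesianMonoidalCategory C] [HasFiniteLimits C]
  [HasSubobjectClassifier C] [MonoidalClosed C]

/-! ### Forcing semantics of the connectives -/

/-! A formula is determined by the generalized elements that factor through it, so each internal
statement can be read stage by stage (Kripke–Joyal semantics) and proved by intuitionistic arguments
about elements of `X`, parts and filters at a stage. Disjunctions and existentials need no covers:
`orF_factors` and `exF_factors` describe them by elimination into arbitrary formulas, which is
possible because `orF` and images are encoded by quantifying over `Ω`.

The mathematics then rests on two facts. By `dilation_eq_dilationMeet`, `x ∈ δ(Y)` means that `Y`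
meets every `A ∈ N(x)`: a proper filter containing `N(x)` and `Y` forces this, and conversely `N(x)`
and `Y` generate such a filter (`adjoin`). By `IsTopologicalNbhd.erosion_mem`, `A ∈ N(x)` implies
`ε(A) ∈ N(x)`.

The laws of `ε` are those of an interior operator. Those of `δ` come from testing `Y` against
suitable members of `N(x)`: `ε(D)` for idempotence, `D ∧ (A ⇒ B)` and `D ∧ ε(A)` for the two laws
linking `ε` and `δ`. The Heyting laws hold because the operations on parts are defined elementwise
and commute with change of stage. -/

theorem valid_iff {φ : Subobject (𝟙_ C)} :
    Valid φ ↔ ∀ {Δ : C} (g : Δ ⟶ 𝟙_ C), φ.Factors g := by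
  rw [Valid, sub_ext_iff]
  simp [Subobject.top_factors]

theorem allF_factors {X Γ Δ : C} (φ : (X ⊗ Γ ⟶ Γ) → (X ⊗ Γ ⟶ X) → Subobject (X ⊗ Γ))
    (g : Δ ⟶ Γ) :
    (allF X φ).Factors g ↔ ∀ {Δ' : C} (h : Δ' ⟶ Δ) (x : Δ' ⟶ X),
      (φ (snd X Γ) (fst X Γ)).Factors (lift x (h ≫ g)) :=
  forallSub_factors _ g

theorem valid_allF_iff {X : C} {φ : (X ⊗ 𝟙_ C ⟶ 𝟙_ C) → (X ⊗ 𝟙_ C ⟶ X) → Subobject (X ⊗ 𝟙_ C)} :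
    Valid (allF X φ) ↔ ∀ {Δ : C} (x : Δ ⟶ X),
      (φ (snd X _) (fst X _)).Factors (lift x (toUnit Δ)) := by
  simp only [valid_iff, allF_factors]
  constructor
  · intro H Δ x
    simpa [toUnit_unique (𝟙 Δ ≫ toUnit Δ) (toUnit Δ)] using H (toUnit Δ) (𝟙 Δ) x
  · intro H Δ g Δ' h x
    rw [toUnit_unique (h ≫ g) (toUnit Δ')]
    exact H x

theorem eqF_factors {X Γ Δ : C} (σ τ : Γ ⟶ X) (g : Δ ⟶ Γ) :
    (eqF σ τ).Factors g ↔ g ≫ σ = g ≫ τ :=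
  equalizerSubobject_factors_iff _ _ _

/-- Instantiating `ω` at the truth value of `ψ` at `k` lets falsity eliminate into a formula of any
context, not only of `Γ`. -/
theorem factors_of_botF {Γ Γ' Δ : C} {g : Δ ⟶ Γ} (h : (botF Γ).Factors g) (ψ : Subobject Γ')
    (k : Δ ⟶ Γ') : ψ.Factors k := by
  have := (forallSub_factors _ g).1 h (𝟙 _) (k ≫ chr ψ)
  exact (holds_factors_lift ψ k _).1 this

/-- Letting the target `θ` live in an arbitrary context makes case analysis applicable to any goal
that is a formula at the stage `Δ`. -/
theorem orF_factors {Γ Δ : C} (φ ψ : Subobject Γ) (g : Δ ⟶ Γ) :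
    (orF φ ψ).Factors g ↔ ∀ {Γ' : C} (θ : Subobject Γ') (k : Δ ⟶ Γ'),
      (∀ {Δ' : C} (h : Δ' ⟶ Δ), φ.Factors (h ≫ g) → θ.Factors (h ≫ k)) →
      (∀ {Δ' : C} (h : Δ' ⟶ Δ), ψ.Factors (h ≫ g) → θ.Factors (h ≫ k)) → θ.Factors k := by
  constructor
  · intro H Γ' θ k h1 h2
    have h0 := (forallSub_factors _ g).1 H (𝟙 _) (k ≫ chr θ)
    have aux : ∀ χ : Subobject Γ,
        (∀ {Δ' : C} (h : Δ' ⟶ Δ), χ.Factors (h ≫ g) → θ.Factors (h ≫ k)) →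
        (impF ((Subobject.pullback (snd (Om C) Γ)).obj χ) (holds (fst (Om C) Γ))).Factors
          (lift (k ≫ chr θ) (𝟙 _ ≫ g)) := by
      intro χ hχ
      refine (impF_factors _ _ _).2 fun l hl => ?_
      rw [pullback_factors_iff, Category.assoc, lift_snd, Category.id_comp] at hl
      rw [comp_lift, ← Category.assoc]
      exact (holds_factors_lift θ _ _).2 (hχ _ hl)
    have h3 := (impF_factors _ _ _).1 h0 (𝟙 _) (by simpa using aux φ h1)
    have h4 := (impF_factors _ _ _).1 h3 (𝟙 _) (by simpa using aux ψ h2)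
    rw [Category.id_comp, Category.id_comp] at h4
    exact (holds_factors_lift θ _ _).1 h4
  · intro H
    have hl := isLUB_orF φ ψ
    -- The target formula is the disjunction itself, into which both disjuncts inject.
    exact H _ g (fun h => Subobject.factors_of_le _ (hl.1 (by simp)))
      (fun h => Subobject.factors_of_le _ (hl.1 (by simp)))

/-- Both are the least subobject through which `f` factors. This gives the existential quantifier
its second-order form. -/
theorem imageSubobject_eq_imageSub {A B : C} (f : A ⟶ B) : imageSubobject f = imageSub f :=
  le_antisymm (imageSubobject_le _ ((imageSub f).factorThru f (isLeast_imageSub f).1) (by simp))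
    ((isLeast_imageSub f).2 ((Subobject.mk_factors_iff _ _).2 ⟨factorThruImage f, by simp⟩))

/-- A description of the existential quantifier that only mentions elimination into formulas. -/
theorem exF_factors {X Γ Δ : C} (φ : (X ⊗ Γ ⟶ Γ) → (X ⊗ Γ ⟶ X) → Subobject (X ⊗ Γ))
    (g : Δ ⟶ Γ) :
    (exF X φ).Factors g ↔ ∀ {Γ' : C} (ψ : Subobject Γ') (k : Δ ⟶ Γ'),
      (∀ {Δ' : C} (h : Δ' ⟶ Δ) (x : Δ' ⟶ X),
        (φ (snd X Γ) (fst X Γ)).Factors (lift x (h ≫ g)) → ψ.Factors (h ≫ k)) → ψ.Factors k := by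
  generalize hφ : φ (snd X Γ) (fst X Γ) = φ₀
  have e : exF X φ = imageSub (φ₀.arrow ≫ snd X Γ) := by
    rw [exF, existsSub, hφ, imageSubobject_eq_imageSub]
  rw [e]
  constructor
  · intro H Γ' ψ k hk
    have h0 := (forallSub_factors _ g).1 H (𝟙 _) (k ≫ chr ψ)
    have h1 := (impF_factors _ _ _).1 h0 (𝟙 _)
      ((forallSub_factors _ _).2 fun h a => (impF_factors _ _ _).2 fun l hl => by
        have e := (equalizerSubobject_factors_iff _ _ _).1 hl
        have e' : l ≫ a ≫ φ₀.arrow ≫ snd X Γ = l ≫ h ≫ g := by simpa using e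
        rw [holds_comp, pullback_factors_iff]
        have : (l ≫ lift a (h ≫ 𝟙 _ ≫ lift (k ≫ chr ψ) (𝟙 _ ≫ g))) ≫ snd _ (Om C ⊗ Γ) =
            lift ((l ≫ h ≫ k) ≫ chr ψ) (l ≫ h ≫ g) := by ext <;> simp
        rw [this, holds_factors_lift]
        -- The point `a` of the subobject `φ₀` lies over `g`; its `X`-coordinate is the witness.
        have := hk (l ≫ h) (l ≫ a ≫ φ₀.arrow ≫ fst X Γ) (by
          have : lift (l ≫ a ≫ φ₀.arrow ≫ fst X Γ) ((l ≫ h) ≫ g) = (l ≫ a) ≫ φ₀.arrow := by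
            ext
            · simp
            · simp [e']
          rw [this]
          exact Subobject.factors_comp_arrow _)
        simpa using this)
    rw [Category.id_comp] at h1
    exact (holds_factors_lift ψ _ _).1 h1
  · intro H
    -- The target formula is the image itself: a witness `x` exhibits `h ≫ g` as factoring through
    -- the projection of `φ₀`.
    refine H _ g fun h x hx => ?_
    have : h ≫ g = φ₀.factorThru _ hx ≫ φ₀.arrow ≫ snd X Γ := by
      rw [← Category.assoc, Subobject.factorThru_arrow, lift_snd]
    rw [this]
    exact factors_comp _ (isLeast_imageSub _).1

/-! ### Membership at a stage -/

/-- The element `t` of `X` at the stage `Δ` belongs to the part `A` of `X` at that stage. -/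
def Mem {X Δ : C} (t : Δ ⟶ X) (A : Δ ⟶ P X) : Prop := (elemSub X).Factors (lift t A)

/-- Inclusion of parts of `X` at a stage. -/
def Le {X Δ : C} (A B : Δ ⟶ P X) : Prop :=
  ∀ ⦃Δ' : C⦄ (h : Δ' ⟶ Δ) (x : Δ' ⟶ X), Mem x (h ≫ A) → Mem x (h ≫ B)

/-- A part of `X` at a stage is inhabited in the internal sense. -/
def Inh {X Δ : C} (A : Δ ⟶ P X) : Prop :=
  ∀ ⦃Γ : C⦄ (ψ : Subobject Γ) (k : Δ ⟶ Γ),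
    (∀ ⦃Δ' : C⦄ (h : Δ' ⟶ Δ) (x : Δ' ⟶ X), Mem x (h ≫ A) → ψ.Factors (h ≫ k)) → ψ.Factors k

section Mem

variable {X Γ Δ Δ' : C}

theorem Mem.comp {t : Δ ⟶ X} {A : Δ ⟶ P X} (H : Mem t A) (h : Δ' ⟶ Δ) :
    Mem (h ≫ t) (h ≫ A) := by
  rw [Mem, ← comp_lift]
  exact factors_comp h H

theorem Le.comp {A B : Δ ⟶ P X} (H : Le A B) (h : Δ' ⟶ Δ) : Le (h ≫ A) (h ≫ B) :=
  fun _ k x hx => by simpa using H (k ≫ h) x (by simpa using hx)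

theorem Le.refl (A : Δ ⟶ P X) : Le A A := fun _ _ _ h => h

theorem Le.trans {A B D : Δ ⟶ P X} (h₁ : Le A B) (h₂ : Le B D) : Le A D :=
  fun _ k x hx => h₂ k x (h₁ k x hx)

theorem memF_factors (t : Γ ⟶ X) (A : Γ ⟶ P X) (g : Δ ⟶ Γ) :
    (memF t A).Factors g ↔ Mem (g ≫ t) (g ≫ A) := by
  rw [memF, pullback_factors_iff, comp_lift, Mem]

theorem mem_comp_setOfF (φ : (X ⊗ Γ ⟶ Γ) → (X ⊗ Γ ⟶ X) → Subobject (X ⊗ Γ)) (t : Δ ⟶ X)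
    (g : Δ ⟶ Γ) :
    Mem t (g ≫ setOfF X φ) ↔ (φ (snd X Γ) (fst X Γ)).Factors (lift t g) := by
  have := memF_factors t (g ≫ setOfF X φ) (𝟙 _)
  rw [Category.id_comp, Category.id_comp, setOfF, memF_transpose, pullback_factors_iff,
    Category.id_comp] at this
  exact this.symm

theorem mem_setOfF (φ : (X ⊗ Γ ⟶ Γ) → (X ⊗ Γ ⟶ X) → Subobject (X ⊗ Γ)) (t : Γ ⟶ X) :
    Mem t (setOfF X φ) ↔ (φ (snd X Γ) (fst X Γ)).Factors (lift t (𝟙 Γ)) := by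
  rw [← mem_comp_setOfF, Category.id_comp]

/-- Parts at `Δ` correspond to subobjects of `X ⊗ Δ`, and a generalized element of `X ⊗ Δ` is a
change of stage together with an element of `X` there. -/
theorem Le.antisymm {A B : Δ ⟶ P X} (h₁ : Le A B) (h₂ : Le B A) : A = B := by
  apply MonoidalClosed.uncurry_injective
  rw [← chr_holds (MonoidalClosed.uncurry A), ← chr_holds (MonoidalClosed.uncurry B), chr_inj,
    sub_ext_iff]
  have key : ∀ (D : Δ ⟶ P X) {Δ' : C} (k : Δ' ⟶ X ⊗ Δ),
      (holds (MonoidalClosed.uncurry D)).Factors k ↔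
        Mem (k ≫ fst _ _) ((k ≫ snd _ _) ≫ D) := by
    intro D Δ' k
    have : lift (k ≫ fst _ _) ((k ≫ snd _ _) ≫ D) = k ≫ X ◁ D := by ext <;> simp
    rw [Mem, this, elemSub, ← pullback_factors_iff, ← holds_comp,
      ← MonoidalClosed.uncurry_natural_left, Category.comp_id]
  intro Δ' k
  rw [key, key]
  exact ⟨@h₁ _ _ _, @h₂ _ _ _⟩

theorem part_ext {A B : Δ ⟶ P X}
    (H : ∀ {Δ' : C} (h : Δ' ⟶ Δ) (x : Δ' ⟶ X), Mem x (h ≫ A) ↔ Mem x (h ≫ B)) : A = B :=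
  Le.antisymm (fun _ h x => (H h x).1) (fun _ h x => (H h x).2)

/-! ### The Heyting operations on parts, element by element -/

theorem mem_univT (t : Δ ⟶ X) : Mem t (univT Δ X) :=
  (mem_setOfF _ _).2 (Subobject.top_factors _)

theorem factors_of_mem_emptyT {t : Δ ⟶ X} (H : Mem t (emptyT Δ X)) (ψ : Subobject Γ)
    (k : Δ ⟶ Γ) : ψ.Factors k :=
  factors_of_botF ((mem_setOfF _ _).1 H) ψ k

theorem mem_interT {t : Δ ⟶ X} {A B : Δ ⟶ P X} :
    Mem t (interT A B) ↔ Mem t A ∧ Mem t B := by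
  simp [interT, mem_setOfF, memF_factors, Subobject.inf_factors]

theorem mem_impT {t : Δ ⟶ X} {A B : Δ ⟶ P X} :
    Mem t (impT A B) ↔
      ∀ {Δ' : C} (h : Δ' ⟶ Δ), Mem (h ≫ t) (h ≫ A) → Mem (h ≫ t) (h ≫ B) := by
  simp [impT, mem_setOfF, memF_factors, impF_factors]

theorem mem_unionT {t : Δ ⟶ X} {A B : Δ ⟶ P X} :
    Mem t (unionT A B) ↔ ∀ {Γ : C} (θ : Subobject Γ) (k : Δ ⟶ Γ),
      (∀ {Δ' : C} (h : Δ' ⟶ Δ), Mem (h ≫ t) (h ≫ A) → θ.Factors (h ≫ k)) →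
      (∀ {Δ' : C} (h : Δ' ⟶ Δ), Mem (h ≫ t) (h ≫ B) → θ.Factors (h ≫ k)) → θ.Factors k := by
  simp [unionT, mem_setOfF, memF_factors, orF_factors]

/-! ### Stability of the operations under change of stage -/

theorem comp_univT (g : Δ ⟶ Γ) : g ≫ univT Γ X = univT Δ X :=
  part_ext fun h x => by
    simp [univT, mem_comp_setOfF, ← Category.assoc, Subobject.top_factors]

theorem comp_emptyT (g : Δ ⟶ Γ) : g ≫ emptyT Γ X = emptyT Δ X :=
  part_ext fun h x => by
    rw [← Category.assoc, emptyT, mem_comp_setOfF, emptyT, mem_comp_setOfF]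
    exact ⟨fun H => factors_of_botF H _ _, fun H => factors_of_botF H _ _⟩

theorem comp_interT (g : Δ ⟶ Γ) (A B : Γ ⟶ P X) :
    g ≫ interT A B = interT (g ≫ A) (g ≫ B) :=
  part_ext fun h x => by
    rw [← Category.assoc, interT, interT, mem_comp_setOfF, mem_comp_setOfF]
    simp [memF_factors, Subobject.inf_factors]

theorem comp_unionT (g : Δ ⟶ Γ) (A B : Γ ⟶ P X) :
    g ≫ unionT A B = unionT (g ≫ A) (g ≫ B) :=
  part_ext fun h x => by
    rw [← Category.assoc, unionT, unionT, mem_comp_setOfF, mem_comp_setOfF]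
    simp [memF_factors, orF_factors]

theorem comp_impT (g : Δ ⟶ Γ) (A B : Γ ⟶ P X) :
    g ≫ impT A B = impT (g ≫ A) (g ≫ B) :=
  part_ext fun h x => by
    rw [← Category.assoc, impT, impT, mem_comp_setOfF, mem_comp_setOfF]
    simp [memF_factors, impF_factors]

theorem comp_complT (g : Δ ⟶ Γ) (A : Γ ⟶ P X) : g ≫ complT A = impT (g ≫ A) (emptyT Δ X) :=
  part_ext fun h x => by
    rw [← Category.assoc, complT, impT, mem_comp_setOfF, mem_comp_setOfF, negF, impF_factors,
      impF_factors]
    simp only [memF_factors, comp_emptyT]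
    refine forall_congr' fun Δ'' => forall_congr' fun k => ?_
    simp only [comp_lift, lift_fst, lift_snd_assoc, Category.assoc]
    -- Falsity and membership in the empty part each imply every formula, hence each other.
    exact imp_congr_right fun _ => ⟨fun H => factors_of_botF H _ _,
      fun H => factors_of_mem_emptyT H _ _⟩

/-! ### Heyting laws for parts, the internal order and inhabited parts -/

theorem interT_le_left (A B : Δ ⟶ P X) : Le (interT A B) A := fun _ h x hx => by
  rw [comp_interT, mem_interT] at hx
  exact hx.1

theorem interT_le_right (A B : Δ ⟶ P X) : Le (interT A B) B := fun _ h x hx => by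
  rw [comp_interT, mem_interT] at hx
  exact hx.2

theorem le_interT_iff {A B D : Δ ⟶ P X} : Le D (interT A B) ↔ Le D A ∧ Le D B := by
  refine ⟨fun H => ⟨H.trans (interT_le_left _ _), H.trans (interT_le_right _ _)⟩,
    fun H _ k x hx => ?_⟩
  rw [comp_interT, mem_interT]
  exact ⟨H.1 k x hx, H.2 k x hx⟩

theorem unionT_le_iff {A B D : Δ ⟶ P X} : Le (unionT A B) D ↔ Le A D ∧ Le B D := by
  constructor
  · intro H
    constructor <;> intro _ h x hx <;> refine H h x ?_ <;> rw [comp_unionT, mem_unionT] <;>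
      intro Γ θ k h₁ h₂
    · simpa using h₁ (𝟙 _) (by simpa using hx)
    · simpa using h₂ (𝟙 _) (by simpa using hx)
  · rintro ⟨h₁, h₂⟩ _ h x hx
    rw [comp_unionT, mem_unionT] at hx
    -- Membership in `D` is the formula `elemSub X` evaluated at a pair, so the disjunction may be
    -- eliminated into it.
    refine hx _ _ (fun k hk => ?_) (fun k hk => ?_) <;> rw [comp_lift]
    · simpa [Mem] using h₁ (k ≫ h) _ (by simpa using hk)
    · simpa [Mem] using h₂ (k ≫ h) _ (by simpa using hk)

theorem le_impT_iff {A B D : Δ ⟶ P X} : Le D (impT A B) ↔ Le (interT D A) B := by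
  constructor
  · intro H _ h x hx
    rw [comp_interT, mem_interT] at hx
    have := H h x hx.1
    rw [comp_impT, mem_impT] at this
    simpa using this (𝟙 _) (by simpa using hx.2)
  · intro H _ h x hx
    rw [comp_impT, mem_impT]
    intro Δ'' k hk
    rw [← Category.assoc] at hk ⊢
    refine H _ _ ?_
    rw [comp_interT, mem_interT]
    exact ⟨by simpa using hx.comp k, hk⟩

theorem le_univT (A : Δ ⟶ P X) : Le A (univT Δ X) := fun _ h x _ => by
  rw [comp_univT]
  exact mem_univT x

theorem emptyT_le (A : Δ ⟶ P X) : Le (emptyT Δ X) A := fun _ h x hx => by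
  rw [comp_emptyT] at hx
  exact factors_of_mem_emptyT hx _ _

theorem leF_factors (A B : Γ ⟶ P X) (g : Δ ⟶ Γ) :
    (leF A B).Factors g ↔ Le (g ≫ A) (g ≫ B) := by
  rw [leF, leSub, pullback_factors_iff, eqF_factors, comp_interT]
  simp only [comp_lift, lift_fst, lift_snd]
  exact ⟨fun H => by rw [← H]; exact interT_le_right _ _,
    fun H => (interT_le_left _ _).antisymm (le_interT_iff.2 ⟨Le.refl _, H⟩)⟩

theorem inh_factors (A : Γ ⟶ P X) (g : Δ ⟶ Γ) :
    (exF X fun w x => memF x (w ≫ A)).Factors g ↔ Inh (g ≫ A) := by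
  simp [exF_factors, memF_factors, Inh]

theorem Inh.mono {A B : Δ ⟶ P X} (H : Inh A) (h : Le A B) : Inh B :=
  fun _ ψ k hk => H ψ k fun _ l x hx => hk l x (h l x hx)

theorem Inh.of_mem {A : Δ ⟶ P X} {x : Δ ⟶ X} (h : Mem x A) : Inh A := fun _ ψ k hk => by
  simpa using hk (𝟙 _) x (by simpa using h)

/-- To show that a part is inhabited, one may use an element of an inhabited part. -/
theorem Inh.bind {Y : C} {A : Δ ⟶ P X} {B : Δ ⟶ P Y} (H : Inh A)
    (h : ∀ {Δ' : C} (k : Δ' ⟶ Δ) (x : Δ' ⟶ X), Mem x (k ≫ A) → Inh (k ≫ B)) : Inh B :=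
  fun _ ψ k hk => H ψ k fun _ l x hx => h l x hx ψ _ fun _ m y hy => by
    simpa using hk (m ≫ l) y (by simpa using hy)

end Mem

variable {X Γ Δ Δ' : C}

theorem interT_mono {A A' B B' : Δ ⟶ P X} (hA : Le A A') (hB : Le B B') :
    Le (interT A B) (interT A' B') :=
  le_interT_iff.2 ⟨(interT_le_left _ _).trans hA, (interT_le_right _ _).trans hB⟩

/-! ### Filters at a stage -/

/-- The filters in `X` at the stage `Δ`. -/
structure IsFilterAt (F : Δ ⟶ P (P X)) : Prop where
  inter : ∀ ⦃Δ' : C⦄ (h : Δ' ⟶ Δ) (A B : Δ' ⟶ P X),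
    Mem A (h ≫ F) → Mem B (h ≫ F) → Mem (interT A B) (h ≫ F)
  mono : ∀ ⦃Δ' : C⦄ (h : Δ' ⟶ Δ) (A B : Δ' ⟶ P X), Mem A (h ≫ F) → Le A B → Mem B (h ≫ F)
  univ : Mem (univT Δ X) F
  inh : ∀ ⦃Δ' : C⦄ (h : Δ' ⟶ Δ) (A : Δ' ⟶ P X), Mem A (h ≫ F) → Inh A

theorem filterPred_factors (t : Γ ⟶ P (P X)) (g : Δ ⟶ Γ) :
    (holds (t ≫ filterPred X)).Factors g ↔ IsFilterAt (g ≫ t) := by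
  rw [holds_comp, filterPred, holds_chr, pullback_factors_iff]
  simp only [filterSub, Subobject.inf_factors, allF_factors, impF_factors, memF_factors,
    leF_factors, inh_factors, comp_interT, comp_univT, comp_lift, lift_fst, lift_snd,
    lift_snd_assoc, Category.comp_id]
  constructor
  · rintro ⟨⟨⟨h₁, h₂⟩, h₃⟩, h₄⟩
    refine ⟨fun _ h A B hA hB => ?_, fun _ h A B hA hB => ?_, h₃, fun _ h A hA => ?_⟩
    -- The bound parts `A` and `B` are given at one common stage, so the inner changes of stage are
    -- identities.
    · simpa using h₁ h A (𝟙 _) B (𝟙 _) (by simpa using ⟨hA, hB⟩)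
    · simpa using h₂ h A (𝟙 _) B (𝟙 _) (by simpa using ⟨hA, hB⟩)
    · simpa using h₄ h A (𝟙 _) (by simpa using hA)
  · rintro ⟨h₁, h₂, h₃, h₄⟩
    refine ⟨⟨⟨fun h A _ k B _ l hl => ?_, fun h A _ k B _ l hl => ?_⟩, h₃⟩, fun h A _ k hk => ?_⟩
    · simpa using h₁ (l ≫ k ≫ h) _ _ (by simpa using hl.1) (by simpa using hl.2)
    · simpa using h₂ (l ≫ k ≫ h) _ _ (by simpa using hl.1) hl.2
    · exact h₄ (k ≫ h) _ (by simpa using hk)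

theorem IsFilterAt.mem_interT {F : Δ ⟶ P (P X)} (hF : IsFilterAt F) {A B : Δ ⟶ P X}
    (hA : Mem A F) (hB : Mem B F) : Mem (interT A B) F := by
  simpa using hF.inter (𝟙 _) A B (by simpa using hA) (by simpa using hB)

theorem IsFilterAt.mem_of_le {F : Δ ⟶ P (P X)} (hF : IsFilterAt F) {A B : Δ ⟶ P X}
    (hA : Mem A F) (hAB : Le A B) : Mem B F := by
  simpa using hF.mono (𝟙 _) A B (by simpa using hA) hAB

/-- The parts of `X` that contain `A ∧ Y` for some `A ∈ G`. -/
noncomputable def adjoin (G : Δ ⟶ P (P X)) (Y : Δ ⟶ P X) : Δ ⟶ P (P X) :=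
  setOfF (P X) fun w Z => exF (P X) fun w' A =>
    memF A (w' ≫ w ≫ G) ⊓ leF (interT A (w' ≫ w ≫ Y)) (w' ≫ Z)

theorem mem_adjoin (G : Δ ⟶ P (P X)) (Y : Δ ⟶ P X) (g : Δ' ⟶ Δ) (Z : Δ' ⟶ P X) :
    Mem Z (g ≫ adjoin G Y) ↔ ∀ {Γ : C} (ψ : Subobject Γ) (k : Δ' ⟶ Γ),
      (∀ {Δ'' : C} (h : Δ'' ⟶ Δ') (A : Δ'' ⟶ P X), Mem A (h ≫ g ≫ G) →
        Le (interT A (h ≫ g ≫ Y)) (h ≫ Z) → ψ.Factors (h ≫ k)) → ψ.Factors k := by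
  simp [adjoin, mem_comp_setOfF, exF_factors, memF_factors, leF_factors, comp_interT,
    Subobject.inf_factors]

theorem mem_adjoin_of_mem {G : Δ ⟶ P (P X)} {Y : Δ ⟶ P X} {g : Δ' ⟶ Δ} {A Z : Δ' ⟶ P X}
    (hA : Mem A (g ≫ G)) (h : Le (interT A (g ≫ Y)) Z) : Mem Z (g ≫ adjoin G Y) :=
  (mem_adjoin _ _ _ _).2 fun ψ k hk => by
    simpa using hk (𝟙 _) A (by simpa using hA) (by simpa using h)

/-- If `Y` meets every member of the filter `G`, then `G` and `Y` generate a filter. -/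
theorem IsFilterAt.isFilterAt_adjoin {G : Δ ⟶ P (P X)} (hG : IsFilterAt G) {Y : Δ ⟶ P X}
    (hY : ∀ ⦃Δ' : C⦄ (h : Δ' ⟶ Δ) (A : Δ' ⟶ P X), Mem A (h ≫ G) → Inh (interT A (h ≫ Y))) :
    IsFilterAt (adjoin G Y) where
  inter _ h A B hA hB := by
    rw [mem_adjoin] at hA
    -- The witness `A'` exists only at a later stage; it may be used because the goal is a
    -- membership formula.
    refine hA _ _ fun k A' hA' hle => ?_
    have hB' := hB.comp k
    rw [← Category.assoc, mem_adjoin] at hB'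
    rw [comp_lift]
    refine hB' _ _ fun l B' hB' hle' => ?_
    rw [comp_lift, comp_interT, comp_interT, ← Category.assoc l k (h ≫ _),
      ← Category.assoc (l ≫ k) h]
    -- If `A' ∧ Y ≼ A` and `B' ∧ Y ≼ B`, then `A' ∧ B'` witnesses that `A ∧ B` is in the generated
    -- filter.
    refine mem_adjoin_of_mem (A := interT (l ≫ A') B')
      (hG.inter ((l ≫ k) ≫ h) _ _ (by simpa using hA'.comp l) (by simpa using hB'))
      (le_interT_iff.2 ⟨?_, ?_⟩)
    · refine (interT_mono (interT_le_left _ _) (Le.refl _)).trans ?_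
      simpa [comp_interT] using hle.comp l
    · refine (interT_mono (interT_le_right _ _) (Le.refl _)).trans ?_
      simpa using hle'
  mono _ h A B hA hAB := by
    rw [mem_adjoin] at hA
    refine hA _ _ fun k A' hA' hle => ?_
    rw [comp_lift, ← Category.assoc]
    exact mem_adjoin_of_mem (by simpa using hA') (by simpa using hle.trans (hAB.comp k))
  univ := by
    have := mem_adjoin_of_mem (g := 𝟙 _) (Y := Y) (by simpa using hG.univ) (le_univT _)
    simpa using this
  inh _ h A hA := fun _ ψ k hk => by
    rw [mem_adjoin] at hA
    refine hA _ _ fun l A' hA' hle => ?_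
    -- Properness is where `hY` enters: `A` contains the inhabited part `A' ∧ Y`.
    have := (hY (l ≫ h) A' (by simpa using hA')).mono (by simpa using hle)
    exact this _ _ fun _ m x hx => by simpa using hk (m ≫ l) x (by simpa using hx)

theorem le_adjoin (G : Δ ⟶ P (P X)) (Y : Δ ⟶ P X) : Le G (adjoin G Y) :=
  fun _ _ _ hA => mem_adjoin_of_mem hA (interT_le_left _ _)

theorem IsFilterAt.mem_adjoin_self {G : Δ ⟶ P (P X)} (hG : IsFilterAt G) (Y : Δ ⟶ P X) :
    Mem Y (adjoin G Y) := by
  simpa using mem_adjoin_of_mem (g := 𝟙 _) (Y := Y) (by simpa using hG.univ)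
    (interT_le_right _ _)

/-! ### Erosion and dilation at a stage -/

theorem mem_erosion (N : X ⟶ P (P X)) (Y : Δ ⟶ P X) (t : Δ ⟶ X) :
    Mem t (Y ≫ erosion N) ↔ Mem Y (t ≫ N) := by
  simp [erosion, mem_comp_setOfF, memF_factors]

theorem mem_dilationMeet (N : X ⟶ P (P X)) (Y : Δ ⟶ P X) (t : Δ ⟶ X) :
    Mem t (Y ≫ dilationMeet N) ↔ ∀ ⦃Δ' : C⦄ (h : Δ' ⟶ Δ) (A : Δ' ⟶ P X),
      Mem A (h ≫ t ≫ N) → Inh (interT A (h ≫ Y)) := by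
  simp only [dilationMeet, mem_comp_setOfF, allF_factors, impF_factors, memF_factors,
    exF_factors, comp_interT, comp_lift, lift_fst, lift_snd, lift_fst_assoc,
    lift_snd_assoc, Category.assoc]
  constructor
  · intro H Δ' h A hA Γ ψ k hk
    refine H h A (𝟙 _) (by simpa using hA) ψ k fun l x hx => hk l x ?_
    simpa [comp_interT] using hx
  · intro H Δ' h A Δ'' k hA Γ ψ l hl
    refine H (k ≫ h) (k ≫ A) (by simpa using hA) ψ l fun _ m x hx => hl m x ?_
    simpa [comp_interT] using hx

theorem mem_dilation (N : X ⟶ P (P X)) (Y : Δ ⟶ P X) (t : Δ ⟶ X) :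
    Mem t (Y ≫ dilation N) ↔ ∀ {Γ : C} (ψ : Subobject Γ) (k : Δ ⟶ Γ),
      (∀ {Δ' : C} (h : Δ' ⟶ Δ) (F : Δ' ⟶ P (P X)), IsFilterAt F → Mem (h ≫ Y) F →
        Le (h ≫ t ≫ N) F → ψ.Factors (h ≫ k)) → ψ.Factors k := by
  simp [dilation, mem_comp_setOfF, exF_factors, memF_factors, leF_factors, filterPred_factors,
    Subobject.inf_factors]

/-- If `F` contains `N(t)` and `Y`, then `A ∧ Y ∈ F` for every `A ∈ N(t)`, and members of `F` are
inhabited. Conversely the filter generated by `N(t)` and `Y` is an explicit witness, so no choice is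
involved. -/
theorem dilation_eq_dilationMeet {N : X ⟶ P (P X)}
    (hN : ∀ ⦃Δ : C⦄ (x : Δ ⟶ X), IsFilterAt (x ≫ N)) : dilation N = dilationMeet N :=
  part_ext fun Y t => by
    rw [mem_dilation, mem_dilationMeet]
    constructor
    · intro H
      -- The goal is folded back into a formula so that the existential over `F` can be eliminated
      -- into it.
      rw [← mem_dilationMeet]
      refine H _ _ fun h F hF hY hle => ?_
      rw [comp_lift, ← Category.assoc]
      refine (mem_dilationMeet _ _ _).2 fun _ k A hA => ?_
      exact hF.inh k _ (hF.inter k _ _ (hle k _ (by simpa using hA)) (hY.comp k))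
    · intro H Γ ψ k hk
      simpa using hk (𝟙 _) (adjoin (t ≫ N) Y) ((hN t).isFilterAt_adjoin H)
        (by simpa using (hN t).mem_adjoin_self Y) (by simpa using le_adjoin _ _)

/-! ### Topological neighborhoods at a stage -/

namespace IsTopologicalNbhd

variable {N : X ⟶ P (P X)}

theorem isFilterAt (hN : IsTopologicalNbhd N) (x : Δ ⟶ X) : IsFilterAt (x ≫ N) := by
  have := valid_allF_iff.1 hN.filter x
  rw [filterPred_factors] at this
  simpa using this

theorem mem_of_mem (hN : IsTopologicalNbhd N) {x : Δ ⟶ X} {A : Δ ⟶ P X} (hA : Mem A (x ≫ N)) :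
    Mem x A := by
  have := valid_allF_iff.1 hN.mem x
  simp only [allF_factors, impF_factors, memF_factors] at this
  simpa using this (𝟙 _) A (𝟙 _) (by simpa using hA)

/-- The part `B` given by the topological axiom satisfies `B ≼ ε(A)`, and `N(x)` is upward closed.
-/
theorem erosion_mem (hN : IsTopologicalNbhd N) {x : Δ ⟶ X} {A : Δ ⟶ P X}
    (hA : Mem A (x ≫ N)) : Mem (A ≫ erosion N) (x ≫ N) := by
  have := valid_allF_iff.1 hN.topological x
  simp only [allF_factors, impF_factors, memF_factors, exF_factors, Subobject.inf_factors] at this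
  refine this (𝟙 _) A (𝟙 _) (by simpa using hA) _ _ fun h B hB => ?_
  rw [comp_lift, ← Category.assoc h x N]
  refine (hN.isFilterAt (h ≫ x)).mem_of_le (A := B) (by simpa using hB.1) fun _ k y hy => ?_
  rw [← Category.assoc, ← Category.assoc, mem_erosion]
  simpa using hB.2 k y (𝟙 _) (by simpa using hy)

theorem mem_dilation_iff (hN : IsTopologicalNbhd N) (Y : Δ ⟶ P X) (t : Δ ⟶ X) :
    Mem t (Y ≫ dilation N) ↔ ∀ ⦃Δ' : C⦄ (h : Δ' ⟶ Δ) (A : Δ' ⟶ P X),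
      Mem A (h ≫ t ≫ N) → Inh (interT A (h ≫ Y)) := by
  rw [dilation_eq_dilationMeet fun _ => hN.isFilterAt, mem_dilationMeet]

theorem erosion_le (hN : IsTopologicalNbhd N) (A : Δ ⟶ P X) : Le (A ≫ erosion N) A :=
  fun _ h x hx => by
    rw [← Category.assoc, mem_erosion] at hx
    exact hN.mem_of_mem hx

theorem erosion_mono (hN : IsTopologicalNbhd N) {A B : Δ ⟶ P X} (hAB : Le A B) :
    Le (A ≫ erosion N) (B ≫ erosion N) := fun _ h x hx => by
  rw [← Category.assoc, mem_erosion] at hx ⊢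
  exact (hN.isFilterAt x).mem_of_le hx (hAB.comp h)

theorem erosion_univT (hN : IsTopologicalNbhd N) : univT Δ X ≫ erosion N = univT Δ X :=
  (le_univT _).antisymm fun _ h x _ => by
    rw [← Category.assoc, mem_erosion, comp_univT]
    exact (hN.isFilterAt x).univ

theorem erosion_interT (hN : IsTopologicalNbhd N) (A B : Δ ⟶ P X) :
    interT A B ≫ erosion N = interT (A ≫ erosion N) (B ≫ erosion N) :=
  Le.antisymm
    (le_interT_iff.2 ⟨hN.erosion_mono (interT_le_left _ _), hN.erosion_mono (interT_le_right _ _)⟩)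
    fun _ h x hx => by
      rw [comp_interT, mem_interT, ← Category.assoc, ← Category.assoc, mem_erosion,
        mem_erosion] at hx
      rw [← Category.assoc, mem_erosion, comp_interT]
      exact (hN.isFilterAt x).mem_interT hx.1 hx.2

theorem erosion_erosion (hN : IsTopologicalNbhd N) (A : Δ ⟶ P X) :
    (A ≫ erosion N) ≫ erosion N = A ≫ erosion N :=
  (hN.erosion_le _).antisymm fun _ h x hx => by
    rw [← Category.assoc, mem_erosion] at hx
    rw [← Category.assoc, mem_erosion, ← Category.assoc]
    exact hN.erosion_mem hx

theorem dilation_mono (hN : IsTopologicalNbhd N) {A B : Δ ⟶ P X} (hAB : Le A B) :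
    Le (A ≫ dilation N) (B ≫ dilation N) := fun _ h x hx => by
  rw [← Category.assoc, hN.mem_dilation_iff] at hx ⊢
  exact fun _ k D hD => (hx k D hD).mono (interT_mono (Le.refl _) ((hAB.comp h).comp k))

theorem le_dilation (hN : IsTopologicalNbhd N) (A : Δ ⟶ P X) : Le A (A ≫ dilation N) :=
  fun _ h x hx => by
    rw [← Category.assoc, hN.mem_dilation_iff]
    intro _ k D hD
    rw [← Category.assoc] at hD
    exact Inh.of_mem (mem_interT.2 ⟨hN.mem_of_mem hD, hx.comp k⟩)

/-- For `D ∈ N(x)`, also `ε(D) ∈ N(x)`, so `ε(D)` meets `δ(A)` at some `y`. Then `D ∈ N(y)` and `y ∈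
δ(A)`, hence `D` meets `A`. -/
theorem dilation_dilation (hN : IsTopologicalNbhd N) (A : Δ ⟶ P X) :
    (A ≫ dilation N) ≫ dilation N = A ≫ dilation N :=
  Le.antisymm (fun _ h x hx => by
    rw [← Category.assoc, hN.mem_dilation_iff] at hx
    rw [← Category.assoc, hN.mem_dilation_iff]
    intro _ k D hD
    rw [← Category.assoc] at hD
    refine (hx k _ (by simpa using hN.erosion_mem hD)).bind fun l y hy => ?_
    rw [comp_interT, mem_interT, ← Category.assoc, mem_erosion] at hy
    have hA : Mem y ((l ≫ k ≫ h ≫ A) ≫ dilation N) := by simpa using hy.2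
    rw [hN.mem_dilation_iff] at hA
    simpa [comp_interT] using hA (𝟙 _) (l ≫ D) (by simpa using hy.1))
  (hN.le_dilation _)

theorem dilation_emptyT (hN : IsTopologicalNbhd N) :
    emptyT Δ X ≫ dilation N = emptyT Δ X :=
  Le.antisymm (fun _ h x hx => by
    rw [← Category.assoc, hN.mem_dilation_iff] at hx
    -- Testing against the neighborhood `X` produces an element of `X ∧ ∅`.
    refine hx (𝟙 _) (univT _ X) (by simpa using (hN.isFilterAt x).univ) _ _ fun _ k y hy => ?_
    rw [comp_interT, mem_interT] at hy
    simp only [comp_emptyT] at hy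
    exact factors_of_mem_emptyT hy.2 _ _)
  (emptyT_le _)

/-- If `A ⇒ B` and `D` are in `N(x)`, so is their intersection; it meets `A`, and a common element
lies in `D ∧ B` by modus ponens. -/
theorem erosion_impT_le (hN : IsTopologicalNbhd N) (A B : Δ ⟶ P X) :
    Le (impT A B ≫ erosion N) (impT (A ≫ dilation N) (B ≫ dilation N)) := by
  refine le_impT_iff.2 fun _ h x hx => ?_
  rw [comp_interT, mem_interT, ← Category.assoc, ← Category.assoc, mem_erosion,
    hN.mem_dilation_iff] at hx
  rw [← Category.assoc, hN.mem_dilation_iff]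
  intro _ k D hD
  have hI : Mem (interT D (k ≫ h ≫ impT A B)) (k ≫ x ≫ N) := by
    rw [← Category.assoc k x N] at hD ⊢
    exact (hN.isFilterAt (k ≫ x)).mem_interT hD (by simpa using hx.1.comp k)
  refine (hx.2 k _ hI).mono (le_interT_iff.2
    ⟨(interT_le_left _ _).trans (interT_le_left _ _), ?_⟩)
  rw [comp_impT, comp_impT]
  exact (interT_mono (interT_le_right _ _) (Le.refl _)).trans (le_impT_iff.1 (Le.refl _))

/-- Here `D ∧ ε(A)` is a neighborhood of `x` by `erosion_mem`, so it meets `B`; this says that `D`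
meets `ε(A) ∧ B`. -/
theorem interT_erosion_dilation_le (hN : IsTopologicalNbhd N) (A B : Δ ⟶ P X) :
    Le (interT (A ≫ erosion N) (B ≫ dilation N)) (interT (A ≫ erosion N) B ≫ dilation N) := by
  intro _ h x hx
  rw [comp_interT, mem_interT, ← Category.assoc, ← Category.assoc, mem_erosion,
    hN.mem_dilation_iff] at hx
  rw [← Category.assoc, hN.mem_dilation_iff]
  intro _ k D hD
  have hI : Mem (interT D (k ≫ h ≫ A ≫ erosion N)) (k ≫ x ≫ N) := by
    rw [← Category.assoc k x N] at hD ⊢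
    exact (hN.isFilterAt (k ≫ x)).mem_interT hD
      (by simpa using (hN.erosion_mem hx.1).comp k)
  refine (hx.2 k _ hI).mono ?_
  rw [comp_interT, comp_interT]
  refine le_interT_iff.2 ⟨(interT_le_left _ _).trans (interT_le_left _ _), ?_⟩
  exact interT_mono (interT_le_right _ _) (by simpa using Le.refl _)

end IsTopologicalNbhd

/-! ### The modal algebra of parts -/

section PowerSignature

variable (N : X ⟶ P (P X)) (A B : Δ ⟶ P X)

theorem powerSignature_leq : (powerSignature N).leq A B = leF A B := rfl

theorem powerSignature_inf : (powerSignature N).inf A B = interT A B := by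
  simp [ModalSignature.inf, powerSignature, comp_interT]

theorem powerSignature_sup : (powerSignature N).sup A B = unionT A B := by
  simp [ModalSignature.sup, powerSignature, comp_unionT]

theorem powerSignature_himp : (powerSignature N).himp A B = impT A B := by
  simp [ModalSignature.himp, powerSignature, comp_impT]

theorem powerSignature_one : (powerSignature N).one Δ = univT Δ X := comp_univT _

theorem powerSignature_zero : (powerSignature N).zero Δ = emptyT Δ X := comp_emptyT _

theorem comp_powerSignature_neg : A ≫ (powerSignature N).neg = impT A (emptyT Δ X) := by
  simp [powerSignature, comp_complT]

end PowerSignature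

theorem iffF_factors (φ ψ : Subobject Γ) (g : Δ ⟶ Γ) :
    (iffF φ ψ).Factors g ↔ ∀ {Δ' : C} (h : Δ' ⟶ Δ), φ.Factors (h ≫ g) ↔ ψ.Factors (h ≫ g) := by
  rw [iffF, Subobject.inf_factors, impF_factors, impF_factors]
  exact ⟨fun H _ h => ⟨H.1 h, H.2 h⟩, fun H => ⟨fun h => (H h).1, fun h => (H h).2⟩⟩

theorem isHeyting_powerSignature (N : X ⟶ P (P X)) : (powerSignature N).IsHeyting := by
  constructor <;>
    simp only [valid_allF_iff, allF_factors, impF_factors, iffF_factors, Subobject.inf_factors,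
      eqF_factors, powerSignature_leq, powerSignature_inf, powerSignature_sup,
      powerSignature_himp, powerSignature_one, powerSignature_zero, comp_powerSignature_neg,
      leF_factors, comp_interT, comp_unionT, comp_impT, comp_univT, comp_emptyT, comp_lift,
      lift_fst, lift_snd_assoc]
  · exact fun A => Le.refl A
  · exact fun A _ h B _ k D _ l H => H.1.trans H.2
  · exact fun A _ h B _ k H => H.1.antisymm H.2
  · exact fun A => le_univT A
  · exact fun A => emptyT_le A
  · exact fun A _ h B _ k D _ l => le_interT_iff
  · exact fun A _ h B _ k D _ l => unionT_le_iff
  · exact fun A _ h B _ k D _ l => le_impT_iff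
  -- Both sides have already been rewritten to `A ⇒ ∅`.
  · exact fun A => trivial

theorem IsTopologicalNbhd.isCS4Algebra {N : X ⟶ P (P X)} (hN : IsTopologicalNbhd N) :
    (powerSignature N).IsCS4Algebra := by
  have box : (powerSignature N).box = erosion N := rfl
  have dia : (powerSignature N).dia = dilation N := rfl
  refine ⟨isHeyting_powerSignature N, ?_, ?_, ?_, ?_, ?_, ?_, ?_, ?_, ?_⟩ <;>
    simp only [valid_allF_iff, allF_factors, impF_factors, eqF_factors,
      powerSignature_leq, powerSignature_inf, powerSignature_himp, powerSignature_one, box, dia,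
      leF_factors, comp_interT, comp_impT, comp_lift, lift_fst,
      lift_fst_assoc, lift_snd_assoc, Category.assoc]
  · exact fun A => hN.erosion_le A
  · refine valid_iff.2 fun g => (eqF_factors _ _ _).2 ?_
    rw [← Category.assoc, comp_univT, hN.erosion_univT]
  · intro Δ A Δ' h B
    -- The change of context must act on the intersection before `ε` can be distributed over it.
    rw [← Category.assoc (lift _ _), comp_interT, hN.erosion_interT]
    simp
  · exact fun A => by simpa using hN.erosion_erosion A
  · exact fun A _ h B _ k H => by simpa using hN.dilation_mono H
  · exact fun A => hN.le_dilation A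
  · exact fun A => by simpa using hN.dilation_dilation A
  · intro Δ A Δ' h B
    rw [← Category.assoc (lift _ _), comp_impT]
    simpa using hN.erosion_impT_le (h ≫ A) B
  · intro Δ A Δ' h B
    rw [← Category.assoc (lift _ _), comp_interT]
    simpa using hN.interT_erosion_dilation_le (h ≫ A) B

end

end ToposLogic

theorem proposition9 {C : Type u} [Category.{v} C] [CartesianMonoidalCategory C]
    [HasFiniteLimits C] [MonoidalClosed C] [HasSubobjectClassifier C]
    {X : C} (N : X ⟶ ToposLogic.P (ToposLogic.P X)) (hN : ToposLogic.IsTopologicalNbhd N) :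
    -- the two descriptions of `δ[N]` agree
    ToposLogic.dilation N = ToposLogic.dilationMeet N ∧
    -- `∀ Y, Y ≼ δ[N](Y)`
    ToposLogic.Valid (ToposLogic.allF (ToposLogic.P X) fun _ Y =>
      ToposLogic.leF Y (Y ≫ ToposLogic.dilation N)) ∧
    -- `δ[N](∅) = ∅`
    ToposLogic.Valid (ToposLogic.eqF (ToposLogic.emptyT (𝟙_ C) X ≫ ToposLogic.dilation N)
      (ToposLogic.emptyT (𝟙_ C) X)) ∧
    -- `∀ Y, δ[N](δ[N](Y)) = δ[N](Y)`
    ToposLogic.Valid (ToposLogic.allF (ToposLogic.P X) fun _ Y =>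
      ToposLogic.eqF ((Y ≫ ToposLogic.dilation N) ≫ ToposLogic.dilation N)
        (Y ≫ ToposLogic.dilation N)) ∧
    -- `P X` with `ε[N]` and `δ[N]` is an internal CS4-modal algebra
    (ToposLogic.powerSignature N).IsCS4Algebra := by
  refine ⟨ToposLogic.dilation_eq_dilationMeet fun _ => hN.isFilterAt, ?_, ?_, ?_,
    hN.isCS4Algebra⟩
  -- The order and `dia` of `powerSignature N` unfold to `leF` and `dilation N`.
  · exact hN.isCS4Algebra.le_dia
  · exact ToposLogic.valid_iff.2 fun g =>
      (ToposLogic.eqF_factors _ _ _).2 (by rw [hN.dilation_emptyT])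
  · exact hN.isCS4Algebra.dia_dia
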